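/- **Setting.** Formulas $\varphi$ of Gödel temporal logic are built from a countably infinite set of propositional variables with $\wedge,\vee,\Rightarrow$, co-implication $\Leftarrow$, $\mathsf X$ (next), $\mathsf Y$ (yesterday), $\mathsf G$ (always in the future), $\mathsf H$ (always in the past), $\mathbin{\mathsf U}$ (until) and $\mathbin{\mathsf S}$ (since). *Falsifiability.* A flow is a set $T$ with a bijection $S\colon T\to T$. A real valuation $V$ assigns to each formula and each $t\in T$ a value in $[0,1]$, where $\wedge,\vee$ are $\min,\max$; $V(\varphi\Rightarrow\psi,t)$ is $1$ if $V(\varphi,t)\le V(\psi,t)$ and $V(\psi,t)$ otherwise; $V(\varphi\Leftarrow\psi,t)$ is $0$ if $V(\varphi,t)\le V(\psi,t)$ and $V(\varphi,t)$ otherwise; $V(\mathsf X\varphi,t)=V(\varphi,S(t))$; $V(\mathsf G\varphi,t)=\inf_{n\ge 0}V(\varphi,S^n(t))$; $V(\varphi\mathbin{\mathsf U}\psi,t)=\sup_{n\ge0}\min\{V(\varphi,S^0(t)),\dots,V(\varphi,S^{n-1}(t)),V(\psi,S^n(t))\}$; and $\mathsf Y,\mathsf H,\mathbin{\mathsf S}$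 are interpreted likewise with $S^{-1}$ in place of $S$. A bi-relational model consists of a linear order $(W,\le)$, a flow $(T,S)$ and a set $[\![\varphi]\!]\subseteq W\times T$ for each formula, where $[\![p]\!]$ is downward closed in the first coordinate for each variable $p$; $\wedge,\vee$ are $\cap,\cup$; $(w,t)\in[\![\varphi\Rightarrow\psi]\!]$ iff for all $v\le w$, $(v,t)\in[\![\varphi]\!]$ implies $(v,t)\in[\![\psi]\!]$; $(w,t)\in[\![\varphi\Leftarrow\psi]\!]$ iff there is $v\ge w$ with $(v,t)\in[\![\varphi]\!]$ and $(v,t)\notin[\![\psi]\!]$; and the temporal connectives are read classically along $t\mapsto S(t)$ with $w$ fixed ($\mathsf G,\mathsf H,\mathbin{\mathsf U},\mathbin{\mathsf S}$ including the present). A formula $\varphi$ is *falsifiable* if some real valuation on some flow gives it a value $<1$ at some point, or if $[\![\varphi]\!]\ne W\times T$ in some bi-relational model. *Quasimodels.* Let $\Sigma$ be a set of formulas closed under subformulas. A *$\Sigma$-type* is a set $\Phi\subseteq\Sigma$ such that, for the indicated compound formulas in $\Sigma$: $\varphi\wedge\psi\in\Phi$ iff $\varphi\in\Phi$ and $\psi\in\Phi$;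 $\varphi\vee\psi\in\Phi$ iff $\varphi\in\Phi$ or $\psi\in\Phi$; $\varphi\Rightarrow\psi\in\Phi$ implies $\varphi\notin\Phi$ or $\psi\in\Phi$; $\psi\in\Phi$ implies $\varphi\Rightarrow\psi\in\Phi$; $\varphi\Leftarrow\psi\in\Phi$ implies $\varphi\in\Phi$; and $\varphi\in\Phi$, $\psi\notin\Phi$ imply $\varphi\Leftarrow\psi\in\Phi$. A *$\Sigma$-labelled space* $(W,\le,\ell)$ is a poset that is a disjoint union of linear posets, with a $\Sigma$-type $\ell(w)$ for each $w\in W$, such that $w\le v$ implies $\ell(w)\supseteq\ell(v)$; whenever $\varphi\Rightarrow\psi\in\Sigma\setminus\ell(w)$ there is $v\le w$ with $\varphi\in\ell(v)$, $\psi\notin\ell(v)$; and whenever $\varphi\Leftarrow\psi\in\ell(w)$ there is $v\ge w$ with $\varphi\in\ell(v)$, $\psi\notin\ell(v)$. It *falsifies* $\varphi$ if $\varphi\in\Sigma\setminus\ell(w)$ for some $w$. Its *height* is the supremum of all $n$ for which there is a chain $w_1<\dots<w_n$. The *linear component* of $w$ is $\{v : v\le w\text{ or }w\le v\}$. A *$\Sigma$-quasimodel*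 $(W,\le,\ell,R)$ is a $\Sigma$-labelled space with a relation $R\subseteq W\times W$ such that: - every $w$ has an $R$-successor and an $R$-predecessor; - for each $w$, the sets $\{v: w\mathrel R v\}$ and $\{v: v\mathrel R w\}$ are convex in $(W,\le)$ (i.e. contain $b$ whenever they contain $a,c$ with $a\le b\le c$); - $R$ is fully confluent: if $x\le x'\mathrel R y'$ there is $y$ with $x\mathrel R y\le y'$; if $x'\ge x\mathrel R y$ there is $y'$ with $x'\mathrel R y'\ge y$; if $x'\mathrel R y'\ge y$ there is $x$ with $x'\ge x\mathrel R y$; if $x\mathrel R y\le y'$ there is $x'$ with $x\le x'\mathrel R y'$; - $R$ is sensible: whenever $w\mathrel R v$, for the indicated compound formulas in $\Sigma$, $\mathsf X\varphi\in\ell(w)$ iff $\varphi\in\ell(v)$; $\mathsf Y\varphi\in\ell(v)$ iff $\varphi\in\ell(w)$; $\mathsf G\varphi\in\ell(w)$ iff $\varphi\in\ell(w)$ and $\mathsf G\varphi\in\ell(v)$; $\mathsf H\varphi\in\ell(v)$ iff $\varphi\in\ell(v)$ and $\mathsf H\varphi\in\ell(w)$; $\varphi\mathbin{\mathsf U}\psi\in\ell(w)$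 iff $\psi\in\ell(w)$ or ($\varphi\in\ell(w)$ and $\varphi\mathbin{\mathsf U}\psi\in\ell(v)$); $\varphi\mathbin{\mathsf S}\psi\in\ell(v)$ iff $\psi\in\ell(v)$ or ($\varphi\in\ell(v)$ and $\varphi\mathbin{\mathsf S}\psi\in\ell(w)$); - $R$ is $\omega$-sensible: whenever $\mathsf G\varphi\in\Sigma\setminus\ell(w)$ (resp. $\mathsf H\varphi\in\Sigma\setminus\ell(w)$) there are $n\ge0$ and $v$ with $w\mathrel{R^n}v$ (resp. $v\mathrel{R^n}w$) and $\varphi\in\Sigma\setminus\ell(v)$; whenever $\varphi\mathbin{\mathsf U}\psi\in\ell(w)$ (resp. $\varphi\mathbin{\mathsf S}\psi\in\ell(w)$) there are $n\ge0$ and $v$ with $w\mathrel{R^n}v$ (resp. $v\mathrel{R^n}w$) and $\psi\in\ell(v)$. *Ultimate periodicity.* A quasimodel $(W,\le,\ell,R)$ is *ultimately periodic* if there are integers $i',l',i,l\ge1$ and a map $\pi\colon W\to T=\{-(i'+l'-1),\dots,i+l-1\}$ such that each fibre $\pi^{-1}(t)$, $t\in T$, is an entire linear component of $W$, and $w\mathrel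 R v$ implies that $(\pi(w),\pi(v))$ is an edge of the "double lasso" on $T$, whose edges are $k\to k+1$ for $-(i'+l'-1)\le k\le i+l-2$, together with $i+l-1\to i$ and $-i'\to-(i'+l'-1)$. (So $T$ consists of a past loop, a middle segment containing $0$, and a future loop.) **Theorem (ultimately periodic quasimodel property).** Let $\varphi$ be a falsifiable formula and let $\Sigma$ be a finite set of formulas that is closed under subformulas and contains $\varphi$ (for example, the set of subformulas of $\varphi$). Then there is an ultimately periodic $\Sigma$-quasimodel of height at most $|\Sigma|+1$ that falsifies $\varphi$. -/

import Mathlib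

namespace GTL

/-- Formulas of Gödel temporal logic over the countably infinite set `ℕ` of propositional
variables. -/
inductive Formula : Type where
  /-- a propositional variable -/
  | var (p : ℕ) : Formula
  /-- conjunction -/
  | and (φ ψ : Formula) : Formula
  /-- disjunction -/
  | or (φ ψ : Formula) : Formula
  /-- implication `φ ⇒ ψ` -/
  | imp (φ ψ : Formula) : Formula
  /-- co-implication `φ ⇐ ψ`, the operator dual to implication -/
  | coimp (φ ψ : Formula) : Formula
  /-- `X φ`, next -/
  | next (φ : Formula) : Formula
  /-- `Y φ`, yesterday -/
  | yest (φ : Formula) : Formula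
  /-- `G φ`, going to always be -/
  | glob (φ : Formula) : Formula
  /-- `H φ`, has always been -/
  | hist (φ : Formula) : Formula
  /-- `φ U ψ`, until -/
  | untl (φ ψ : Formula) : Formula
  /-- `φ S ψ`, since -/
  | snce (φ ψ : Formula) : Formula

/-- The set of subformulas of a formula (the formula itself included). -/
def Formula.subformulas : Formula → Set Formula
  | .var p => {.var p}
  | .and φ ψ => insert (.and φ ψ) (φ.subformulas ∪ ψ.subformulas)
  | .or φ ψ => insert (.or φ ψ) (φ.subformulas ∪ ψ.subformulas)
  | .imp φ ψ => insert (.imp φ ψ) (φ.subformulas ∪ ψ.subformulas)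
  | .coimp φ ψ => insert (.coimp φ ψ) (φ.subformulas ∪ ψ.subformulas)
  | .next φ => insert (.next φ) φ.subformulas
  | .yest φ => insert (.yest φ) φ.subformulas
  | .glob φ => insert (.glob φ) φ.subformulas
  | .hist φ => insert (.hist φ) φ.subformulas
  | .untl φ ψ => insert (.untl φ ψ) (φ.subformulas ∪ ψ.subformulas)
  | .snce φ ψ => insert (.snce φ ψ) (φ.subformulas ∪ ψ.subformulas)

/-- `Sig` is closed under subformulas. -/
def SubformulaClosed (Sig : Set Formula) : Prop :=
  ∀ φ ∈ Sig, φ.subformulas ⊆ Sig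

/-! ### Real-valued semantics -/

/-- `V` is a real valuation on the flow `(T, S)`, where `S` is a bijection of `T`. Infima and
suprema are taken in the real unit interval. -/
structure IsRealValuation {T : Type*} (S : Equiv.Perm T) (V : Formula → T → unitInterval) :
    Prop where
  and : ∀ φ ψ t, V (.and φ ψ) t = min (V φ t) (V ψ t)
  or : ∀ φ ψ t, V (.or φ ψ) t = max (V φ t) (V ψ t)
  imp : ∀ φ ψ t, V (.imp φ ψ) t = if V φ t ≤ V ψ t then 1 else V ψ t
  coimp : ∀ φ ψ t, V (.coimp φ ψ) t = if V φ t ≤ V ψ t then 0 else V φ t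
  next : ∀ φ t, V (.next φ) t = V φ (S t)
  yest : ∀ φ t, V (.yest φ) t = V φ (S⁻¹ t)
  glob : ∀ φ t, IsGLB (Set.range fun n : ℕ => V φ ((S ^ n) t)) (V (.glob φ) t)
  hist : ∀ φ t, IsGLB (Set.range fun n : ℕ => V φ ((S⁻¹ ^ n) t)) (V (.hist φ) t)
  untl : ∀ φ ψ t, IsLUB
    (Set.range fun n : ℕ =>
      min ((Finset.range n).inf fun k => V φ ((S ^ k) t)) (V ψ ((S ^ n) t)))
    (V (.untl φ ψ) t)
  snce : ∀ φ ψ t, IsLUB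
    (Set.range fun n : ℕ =>
      min ((Finset.range n).inf fun k => V φ ((S⁻¹ ^ k) t)) (V ψ ((S⁻¹ ^ n) t)))
    (V (.snce φ ψ) t)

/-- Validity over the class of all flows. -/
def RealValid.{u} (φ : Formula) : Prop :=
  ∀ (T : Type u) (S : Equiv.Perm T) (V : Formula → T → unitInterval),
    IsRealValuation S V → ∀ t, V φ t = 1

/-! ### Bi-relational semantics -/

/-- `val` is a bi-relational valuation on the frame `(W, T, ≤, S)`, where `(W, ≤)` is linearly
ordered and `S` is a bijection of `T`. -/
structure IsBiRelValuation {W T : Type*} [LinearOrder W] (S : Equiv.Perm T)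
    (val : Formula → Set (W × T)) : Prop where
  var : ∀ p w v t, v ≤ w → (w, t) ∈ val (.var p) → (v, t) ∈ val (.var p)
  and : ∀ φ ψ, val (.and φ ψ) = val φ ∩ val ψ
  or : ∀ φ ψ, val (.or φ ψ) = val φ ∪ val ψ
  imp : ∀ φ ψ w t, (w, t) ∈ val (.imp φ ψ) ↔ ∀ v ≤ w, (v, t) ∈ val φ → (v, t) ∈ val ψ
  coimp : ∀ φ ψ w t, (w, t) ∈ val (.coimp φ ψ) ↔ ∃ v ≥ w, (v, t) ∈ val φ ∧ (v, t) ∉ val ψ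
  next : ∀ φ w t, (w, t) ∈ val (.next φ) ↔ (w, S t) ∈ val φ
  yest : ∀ φ w t, (w, t) ∈ val (.yest φ) ↔ (w, S⁻¹ t) ∈ val φ
  glob : ∀ φ w t, (w, t) ∈ val (.glob φ) ↔ ∀ n : ℕ, (w, (S ^ n) t) ∈ val φ
  hist : ∀ φ w t, (w, t) ∈ val (.hist φ) ↔ ∀ n : ℕ, (w, (S⁻¹ ^ n) t) ∈ val φ
  untl : ∀ φ ψ w t, (w, t) ∈ val (.untl φ ψ) ↔
    ∃ n : ℕ, (∀ k < n, (w, (S ^ k) t) ∈ val φ) ∧ (w, (S ^ n) t) ∈ val ψ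
  snce : ∀ φ ψ w t, (w, t) ∈ val (.snce φ ψ) ↔
    ∃ n : ℕ, (∀ k < n, (w, (S⁻¹ ^ k) t) ∈ val φ) ∧ (w, (S⁻¹ ^ n) t) ∈ val ψ

/-- Validity over the class of all bi-relational frames. -/
def BiRelValid.{u, v} (φ : Formula) : Prop :=
  ∀ (W : Type u) (T : Type v) [LinearOrder W] (S : Equiv.Perm T) (val : Formula → Set (W × T)),
    IsBiRelValuation S val → val φ = Set.univ

/-! ### Types, labelled spaces, quasimodels -/

/-- `Φ` is a `Sig`-type. -/
structure IsSigType (Sig Φ : Set Formula) : Prop where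
  subset : Φ ⊆ Sig
  and : ∀ φ ψ, .and φ ψ ∈ Sig → (.and φ ψ ∈ Φ ↔ φ ∈ Φ ∧ ψ ∈ Φ)
  or : ∀ φ ψ, .or φ ψ ∈ Sig → (.or φ ψ ∈ Φ ↔ φ ∈ Φ ∨ ψ ∈ Φ)
  imp_elim : ∀ φ ψ, .imp φ ψ ∈ Sig → .imp φ ψ ∈ Φ → φ ∉ Φ ∨ ψ ∈ Φ
  imp_intro : ∀ φ ψ, .imp φ ψ ∈ Sig → ψ ∈ Φ → .imp φ ψ ∈ Φ
  coimp_elim : ∀ φ ψ, .coimp φ ψ ∈ Sig → .coimp φ ψ ∈ Φ → φ ∈ Φ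
  coimp_intro : ∀ φ ψ, .coimp φ ψ ∈ Sig → φ ∈ Φ → ψ ∉ Φ → .coimp φ ψ ∈ Φ

/-- A poset is locally linear if it is a disjoint union of linear posets: it can be partitioned
so that two elements lie in the same block exactly when they are comparable. -/
def LocallyLinear (A : Type*) [PartialOrder A] : Prop :=
  ∃ r : Setoid A, ∀ a b : A, r a b ↔ a ≤ b ∨ b ≤ a

/-- The linear component of `a`. -/
def linearComponent {A : Type*} [PartialOrder A] (a : A) : Set A :=
  {b | a ≤ b ∨ b ≤ a}

/-- `(W, ≤, l)` is a `Sig`-labelled space. -/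
structure IsLabelledSpace {W : Type*} [PartialOrder W] (Sig : Set Formula)
    (l : W → Set Formula) : Prop where
  locallyLinear : LocallyLinear W
  isType : ∀ w, IsSigType Sig (l w)
  antitone : ∀ w v, w ≤ v → l v ⊆ l w
  imp : ∀ w φ ψ, .imp φ ψ ∈ Sig \ l w → ∃ v ≤ w, φ ∈ l v ∧ ψ ∉ l v
  coimp : ∀ w φ ψ, .coimp φ ψ ∈ l w → ∃ v ≥ w, φ ∈ l v ∧ ψ ∉ l v

/-- The labelled space `(W, l)` falsifies `φ`. -/
def Falsifies {W : Type*} (Sig : Set Formula) (l : W → Set Formula) (φ : Formula) : Prop :=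
  ∃ w, φ ∈ Sig \ l w

/-- The height of a poset: the supremum of all `n` such that there is a chain
`w₁ < w₂ < ⋯ < wₙ`. -/
noncomputable def height (W : Type*) [PartialOrder W] : ℕ∞ :=
  ⨆ (n : ℕ) (_ : ∃ w : Fin n → W, StrictMono w), (n : ℕ∞)

/-- Convex relation: all image sets and all preimage sets are convex in the order sense. -/
def ConvexRel {A B : Type*} [PartialOrder A] [PartialOrder B] (R : A → B → Prop) : Prop :=
  (∀ x, Set.OrdConnected {y | R x y}) ∧ (∀ y, Set.OrdConnected {x | R x y})

/-- The four confluence conditions. -/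
structure FullyConfluent {A B : Type*} [PartialOrder A] [PartialOrder B] (R : A → B → Prop) :
    Prop where
  forth_down : ∀ x x' y', x ≤ x' → R x' y' → ∃ y, R x y ∧ y ≤ y'
  forth_up : ∀ x x' y, x ≤ x' → R x y → ∃ y', R x' y' ∧ y ≤ y'
  back_down : ∀ x' y y', R x' y' → y ≤ y' → ∃ x, x ≤ x' ∧ R x y
  back_up : ∀ x y y', R x y → y ≤ y' → ∃ x', x ≤ x' ∧ R x' y'

/-- The ordered pair `(Φ, Ψ)` of `Sig`-types is sensible. -/
structure SensiblePair (Sig Φ Ψ : Set Formula) : Prop where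
  next : ∀ φ, .next φ ∈ Sig → (.next φ ∈ Φ ↔ φ ∈ Ψ)
  yest : ∀ φ, .yest φ ∈ Sig → (.yest φ ∈ Ψ ↔ φ ∈ Φ)
  glob : ∀ φ, .glob φ ∈ Sig → (.glob φ ∈ Φ ↔ φ ∈ Φ ∧ .glob φ ∈ Ψ)
  hist : ∀ φ, .hist φ ∈ Sig → (.hist φ ∈ Ψ ↔ φ ∈ Ψ ∧ .hist φ ∈ Φ)
  untl : ∀ φ ψ, .untl φ ψ ∈ Sig → (.untl φ ψ ∈ Φ ↔ ψ ∈ Φ ∨ (φ ∈ Φ ∧ .untl φ ψ ∈ Ψ))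
  snce : ∀ φ ψ, .snce φ ψ ∈ Sig → (.snce φ ψ ∈ Ψ ↔ ψ ∈ Ψ ∨ (φ ∈ Ψ ∧ .snce φ ψ ∈ Φ))

/-- `R` is `ω`-sensible. The existence of an `n ≥ 0` with `w Rⁿ v` is expressed by the
reflexive transitive closure of `R`. -/
structure OmegaSensible {W : Type*} (Sig : Set Formula) (l : W → Set Formula)
    (R : W → W → Prop) : Prop where
  glob : ∀ w φ, .glob φ ∈ Sig \ l w → ∃ v, Relation.ReflTransGen R w v ∧ φ ∈ Sig \ l v
  hist : ∀ w φ, .hist φ ∈ Sig \ l w → ∃ v, Relation.ReflTransGen R v w ∧ φ ∈ Sig \ l v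
  untl : ∀ w φ ψ, .untl φ ψ ∈ l w → ∃ v, Relation.ReflTransGen R w v ∧ ψ ∈ l v
  snce : ∀ w φ ψ, .snce φ ψ ∈ l w → ∃ v, Relation.ReflTransGen R v w ∧ ψ ∈ l v

/-- `(W, ≤, l, R)` is a `Sig`-labelled system. -/
structure IsLabelledSystem {W : Type*} [PartialOrder W] (Sig : Set Formula)
    (l : W → Set Formula) (R : W → W → Prop) : Prop extends IsLabelledSpace Sig l where
  serial : ∀ w, ∃ v, R w v
  serial_back : ∀ w, ∃ v, R v w
  confluent : FullyConfluent R
  convex : ConvexRel R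
  sensible : ∀ w v, R w v → SensiblePair Sig (l w) (l v)

/-- `(W, ≤, l, R)` is a `Sig`-quasimodel. -/
structure IsQuasimodel {W : Type*} [PartialOrder W] (Sig : Set Formula)
    (l : W → Set Formula) (R : W → W → Prop) : Prop extends IsLabelledSystem Sig l R where
  omega : OmegaSensible Sig l R

/-! ### Ultimately periodic quasimodels -/

/-- The vertex set `{-(i' + l' - 1), …, i + l - 1}` of the double lasso. -/
def lassoVertices (i' l' i l : ℕ) : Set ℤ :=
  Set.Icc (-((i' : ℤ) + l' - 1)) ((i : ℤ) + l - 1)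

/-- The edges of the double lasso: each vertex has an edge to the next one, the last vertex
`i + l - 1` has an edge back to `i`, and `-i'` has an edge back to the first vertex
`-(i' + l' - 1)`. -/
def LassoEdge (i' l' i l : ℕ) (a b : ℤ) : Prop :=
  (-((i' : ℤ) + l' - 1) ≤ a ∧ a ≤ (i : ℤ) + l - 2 ∧ b = a + 1) ∨
  (a = (i : ℤ) + l - 1 ∧ b = i) ∨
  (a = -(i' : ℤ) ∧ b = -((i' : ℤ) + l' - 1))

/-- The relation `R` on the locally linear poset `W` is ultimately periodic: `W` projects to a
double lasso consisting of a past loop `-(i' + l' - 1), …, -i'`, a middle segment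
containing `0`, and a future loop `i, …, i + l - 1`; every fibre is an entire linear component
of `W`, and `R` projects to the edges of the double lasso. -/
def UltimatelyPeriodic {W : Type*} [PartialOrder W] (R : W → W → Prop) : Prop :=
  ∃ i' l' i l : ℕ, 0 < i' ∧ 0 < l' ∧ 0 < i ∧ 0 < l ∧
    ∃ π : W → ℤ,
      (∀ w, π w ∈ lassoVertices i' l' i l) ∧
      (∀ t ∈ lassoVertices i' l' i l, ∃ w, π ⁻¹' {t} = linearComponent w) ∧
      (∀ w v, R w v → LassoEdge i' l' i l (π w) (π v))

end GTL

universe u v w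

/-!
Both semantics describe, at each time, a linearly ordered set of degrees together with the formulas
that hold to each degree, and moving in time keeps the degree. Along the orbit of a point at which
`φ` fails this gives a two-way infinite sequence of linear labelled spaces on the same degrees. As
`Sig` is finite, only finitely many sets of labels can occur, so some set of labels recurs in the
future, and again after all the eventualities pending at its first occurrence have been realised;
likewise in the past. Identifying the two occurrences, and the degrees that share a label at a given
time, folds the sequence to a double lasso.

Folding does no harm because the accessibility relation between consecutive components is the image
of the diagonal of a linear order under a pair of monotone maps: any such relation is fully
confluent and convex, whatever degrees have been identified. Distinct points of a component have
distinct, nested labels, which bounds the height.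
-/

namespace GTL

theorem Formula.self_mem_subformulas (φ : Formula) : φ ∈ φ.subformulas := by
  cases φ <;> simp [Formula.subformulas]

namespace SubformulaClosed

variable {Sig : Set Formula} {φ ψ : Formula}

theorem and (h : SubformulaClosed Sig) (hm : .and φ ψ ∈ Sig) : φ ∈ Sig ∧ ψ ∈ Sig :=
  ⟨h _ hm (.inr (.inl φ.self_mem_subformulas)), h _ hm (.inr (.inr ψ.self_mem_subformulas))⟩

theorem or (h : SubformulaClosed Sig) (hm : .or φ ψ ∈ Sig) : φ ∈ Sig ∧ ψ ∈ Sig :=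
  ⟨h _ hm (.inr (.inl φ.self_mem_subformulas)), h _ hm (.inr (.inr ψ.self_mem_subformulas))⟩

theorem imp (h : SubformulaClosed Sig) (hm : .imp φ ψ ∈ Sig) : φ ∈ Sig ∧ ψ ∈ Sig :=
  ⟨h _ hm (.inr (.inl φ.self_mem_subformulas)), h _ hm (.inr (.inr ψ.self_mem_subformulas))⟩

theorem coimp (h : SubformulaClosed Sig) (hm : .coimp φ ψ ∈ Sig) : φ ∈ Sig ∧ ψ ∈ Sig :=
  ⟨h _ hm (.inr (.inl φ.self_mem_subformulas)), h _ hm (.inr (.inr ψ.self_mem_subformulas))⟩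

theorem untl (h : SubformulaClosed Sig) (hm : .untl φ ψ ∈ Sig) : φ ∈ Sig ∧ ψ ∈ Sig :=
  ⟨h _ hm (.inr (.inl φ.self_mem_subformulas)), h _ hm (.inr (.inr ψ.self_mem_subformulas))⟩

theorem snce (h : SubformulaClosed Sig) (hm : .snce φ ψ ∈ Sig) : φ ∈ Sig ∧ ψ ∈ Sig :=
  ⟨h _ hm (.inr (.inl φ.self_mem_subformulas)), h _ hm (.inr (.inr ψ.self_mem_subformulas))⟩

theorem next (h : SubformulaClosed Sig) (hm : .next φ ∈ Sig) : φ ∈ Sig :=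
  h _ hm (.inr φ.self_mem_subformulas)

theorem yest (h : SubformulaClosed Sig) (hm : .yest φ ∈ Sig) : φ ∈ Sig :=
  h _ hm (.inr φ.self_mem_subformulas)

theorem glob (h : SubformulaClosed Sig) (hm : .glob φ ∈ Sig) : φ ∈ Sig :=
  h _ hm (.inr φ.self_mem_subformulas)

theorem hist (h : SubformulaClosed Sig) (hm : .hist φ ∈ Sig) : φ ∈ Sig :=
  h _ hm (.inr φ.self_mem_subformulas)

end SubformulaClosed

/-! ### Graded valuations -/

/-- The common abstraction of the two semantics: `sat t w` is the set of formulas that hold at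
time `t` to degree `w`, where degrees form a linear order. Until and since obey their unfolding
laws, but the eventuality promised to degree `w` need only be realised at a degree that has the same
`Sig`-type as `w` at the present time. -/
structure IsGradedValuation {L T : Type*} [LinearOrder L] (Sig : Set Formula) (S : Equiv.Perm T)
    (sat : T → L → Set Formula) : Prop where
  antitone : ∀ t, Antitone (sat t)
  and : ∀ φ ψ t w, .and φ ψ ∈ sat t w ↔ φ ∈ sat t w ∧ ψ ∈ sat t w
  or : ∀ φ ψ t w, .or φ ψ ∈ sat t w ↔ φ ∈ sat t w ∨ ψ ∈ sat t w
  imp : ∀ φ ψ t w, .imp φ ψ ∈ sat t w ↔ ∀ v ≤ w, φ ∈ sat t v → ψ ∈ sat t v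
  coimp : ∀ φ ψ t w, .coimp φ ψ ∈ sat t w ↔ ∃ v ≥ w, φ ∈ sat t v ∧ ψ ∉ sat t v
  next : ∀ φ t w, .next φ ∈ sat t w ↔ φ ∈ sat (S t) w
  yest : ∀ φ t w, .yest φ ∈ sat t w ↔ φ ∈ sat (S⁻¹ t) w
  glob : ∀ φ t w, .glob φ ∈ sat t w ↔ ∀ n : ℕ, φ ∈ sat ((S ^ n) t) w
  hist : ∀ φ t w, .hist φ ∈ sat t w ↔ ∀ n : ℕ, φ ∈ sat ((S⁻¹ ^ n) t) w
  untl_unfold : ∀ φ ψ t w,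
    .untl φ ψ ∈ sat t w ↔ ψ ∈ sat t w ∨ φ ∈ sat t w ∧ .untl φ ψ ∈ sat (S t) w
  snce_unfold : ∀ φ ψ t w,
    .snce φ ψ ∈ sat t w ↔ ψ ∈ sat t w ∨ φ ∈ sat t w ∧ .snce φ ψ ∈ sat (S⁻¹ t) w
  untl_realised : ∀ φ ψ t w, .untl φ ψ ∈ sat t w →
    ∃ v, Sig ∩ sat t v = Sig ∩ sat t w ∧ ∃ n : ℕ, ψ ∈ sat ((S ^ n) t) v
  snce_realised : ∀ φ ψ t w, .snce φ ψ ∈ sat t w →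
    ∃ v, Sig ∩ sat t v = Sig ∩ sat t w ∧ ∃ n : ℕ, ψ ∈ sat ((S⁻¹ ^ n) t) v

theorem exists_until_iff {a b : ℕ → Prop} :
    (∃ n, (∀ m < n, a m) ∧ b n) ↔ b 0 ∨ a 0 ∧ ∃ n, (∀ m < n, a (m + 1)) ∧ b (n + 1) := by
  rw [← Nat.or_exists_add_one]
  simp only [Nat.forall_lt_succ_left, not_lt_zero, IsEmpty.forall_iff, implies_true, true_and,
    and_assoc, exists_and_left]

namespace IsBiRelValuation

variable {W T : Type*} [LinearOrder W] {S : Equiv.Perm T} {val : Formula → Set (W × T)}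

theorem isLowerSet (h : IsBiRelValuation S val) (φ : Formula) :
    ∀ t, IsLowerSet {w | (w, t) ∈ val φ} := by
  intro t
  induction φ generalizing t with
  | var p => exact fun w v hvw hm => h.var p w v t hvw hm
  | and φ ψ ihφ ihψ =>
    rw [h.and]
    exact (ihφ t).inter (ihψ t)
  | or φ ψ ihφ ihψ =>
    rw [h.or]
    exact (ihφ t).union (ihψ t)
  | imp φ ψ =>
    simp only [h.imp]
    exact fun w v hvw hm u hu => hm u (hu.trans hvw)
  | coimp φ ψ =>
    simp only [h.coimp]
    exact fun w v hvw ⟨u, hu, hm⟩ => ⟨u, hvw.trans hu, hm⟩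
  | next φ ih => simpa only [h.next] using ih (S t)
  | yest φ ih => simpa only [h.yest] using ih (S⁻¹ t)
  | glob φ ih =>
    simp only [h.glob]
    exact fun w v hvw hm n => ih _ hvw (hm n)
  | hist φ ih =>
    simp only [h.hist]
    exact fun w v hvw hm n => ih _ hvw (hm n)
  | untl φ ψ ihφ ihψ =>
    simp only [h.untl]
    exact fun w v hvw ⟨n, hn, hm⟩ => ⟨n, fun k hk => ihφ _ hvw (hn k hk), ihψ _ hvw hm⟩
  | snce φ ψ ihφ ihψ =>
    simp only [h.snce]
    exact fun w v hvw ⟨n, hn, hm⟩ => ⟨n, fun k hk => ihφ _ hvw (hn k hk), ihψ _ hvw hm⟩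

theorem isGradedValuation (h : IsBiRelValuation S val) (Sig : Set Formula) :
    IsGradedValuation Sig S fun t w => {φ | (w, t) ∈ val φ} where
  antitone t _ _ hvw φ hφ := h.isLowerSet φ t hvw hφ
  and φ ψ t w := by simp only [h.and, Set.mem_ofPred_eq, Set.mem_inter_iff]
  or φ ψ t w := by simp only [h.or, Set.mem_ofPred_eq, Set.mem_union]
  imp φ ψ t w := h.imp φ ψ w t
  coimp φ ψ t w := h.coimp φ ψ w t
  next φ t w := h.next φ w t
  yest φ t w := h.yest φ w t
  glob φ t w := h.glob φ w t
  hist φ t w := h.hist φ w t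
  untl_unfold φ ψ t w := by
    simp only [Set.mem_ofPred_eq, h.untl, ← Equiv.Perm.mul_apply, ← pow_succ]
    exact exists_until_iff
  snce_unfold φ ψ t w := by
    simp only [Set.mem_ofPred_eq, h.snce, ← Equiv.Perm.mul_apply, ← pow_succ]
    exact exists_until_iff
  untl_realised φ ψ t w hm :=
    ⟨w, rfl, ((h.untl φ ψ w t).1 hm).imp fun _ hn => hn.2⟩
  snce_realised φ ψ t w hm :=
    ⟨w, rfl, ((h.snce φ ψ w t).1 hm).imp fun _ hn => hn.2⟩

end IsBiRelValuation

section UntilSupremum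

variable {α : Type*} [LinearOrder α] [OrderTop α] {a b : ℕ → α} {x y : α}

theorem lt_iff_exists_until
    (hx : IsLUB (Set.range fun n => min ((Finset.range n).inf a) (b n)) x) {c : α} :
    c < x ↔ ∃ n, (∀ m < n, c < a m) ∧ c < b n := by
  simp only [lt_isLUB_iff hx, Set.exists_range_iff, lt_min_iff]
  refine exists_congr fun n => and_congr_left fun hc => ?_
  simp only [Finset.lt_inf_iff (hc.trans_le le_top), Finset.mem_range]

theorem until_eq_max_min
    (hx : IsLUB (Set.range fun n => min ((Finset.range n).inf a) (b n)) x)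
    (hy : IsLUB (Set.range fun n => min ((Finset.range n).inf fun m => a (m + 1)) (b (n + 1))) y) :
    x = max (b 0) (min (a 0) y) := by
  refine eq_of_forall_lt_iff fun c => ?_
  rw [lt_iff_exists_until hx, exists_until_iff, lt_max_iff, lt_min_iff, lt_iff_exists_until hy]

end UntilSupremum

theorem exists_lt_forall_le_imp_le {α : Type*} [LinearOrder α] [DenselyOrdered α] {s : Set α}
    (hs : s.Finite) {a w : α} (haw : a < w) : ∃ v, a < v ∧ v < w ∧ ∀ x ∈ s, v ≤ x → w ≤ x := by
  induction s, hs using Set.Finite.induction_on with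
  | empty =>
    obtain ⟨v, hav, hvw⟩ := exists_between haw
    exact ⟨v, hav, hvw, by simp⟩
  | @insert y s _ _ ih =>
    obtain ⟨v, hav, hvw, hs⟩ := ih
    rcases le_or_gt w y with hwy | hyw
    · exact ⟨v, hav, hvw, Set.forall_mem_insert.2 ⟨fun _ => hwy, hs⟩⟩
    · obtain ⟨u, hu, huw⟩ := exists_between (max_lt hvw hyw)
      rw [max_lt_iff] at hu
      exact ⟨u, hav.trans hu.1, huw, Set.forall_mem_insert.2
        ⟨fun huy => absurd hu.2 huy.not_gt, fun x hx hux => hs x hx (hu.1.le.trans hux)⟩⟩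

/-- The degrees to which a formula can hold in the real semantics. Every formula has value at least
`0`, so at degree `0` the clause for co-implication would fail. -/
abbrev PositiveDegree : Type := {x : unitInterval // 0 < x}

/- The suprema in the clauses for until and since need not be attained, but every smaller value is
exceeded; so an eventuality is realised slightly below the degree at which it is pending. -/
theorem PositiveDegree.exists_lt_inter_eq {ι : Type*} {s : Set ι} (hs : s.Finite)
    (val : ι → unitInterval) (w : PositiveDegree) :
    ∃ v < w, s ∩ {χ | v ≤ val χ} = s ∩ {χ | w ≤ val χ} := by
  obtain ⟨v, hv, hvw, hgap⟩ := exists_lt_forall_le_imp_le (hs.image val) w.2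
  refine ⟨⟨v, hv⟩, hvw, Set.ext fun χ => and_congr_right fun hχ => ?_⟩
  exact ⟨hgap _ (Set.mem_image_of_mem val hχ), hvw.le.trans⟩

namespace IsRealValuation

variable {T : Type*} {S : Equiv.Perm T} {V : Formula → T → unitInterval}

theorem le_imp_iff (h : IsRealValuation S V) (φ ψ : Formula) (t : T) (w : PositiveDegree) :
    w ≤ V (.imp φ ψ) t ↔ ∀ v : PositiveDegree, v ≤ w → v ≤ V φ t → v ≤ V ψ t := by
  rw [h.imp]
  split_ifs with hφψ
  · exact iff_of_true unitInterval.le_one' fun v _ hv => hv.trans hφψ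
  refine ⟨fun hw v hvw _ => le_trans hvw hw, fun hw => ?_⟩
  have hpos : 0 < min w.1 (V φ t) := lt_min w.2 (unitInterval.nonneg'.trans_lt (not_le.1 hφψ))
  have hmin := hw ⟨_, hpos⟩ (min_le_left w.1 _) (min_le_right _ _)
  exact (min_le_iff.1 hmin).resolve_right hφψ

theorem le_coimp_iff (h : IsRealValuation S V) (φ ψ : Formula) (t : T) (w : PositiveDegree) :
    w ≤ V (.coimp φ ψ) t ↔ ∃ v : PositiveDegree, v ≥ w ∧ v ≤ V φ t ∧ ¬ v ≤ V ψ t := by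
  rw [h.coimp]
  split_ifs with hφψ
  · exact iff_of_false w.2.not_ge fun ⟨v, _, hvφ, hvψ⟩ => hvψ (hvφ.trans hφψ)
  · exact ⟨fun hw => ⟨⟨V φ t, w.2.trans_le hw⟩, hw, le_rfl, hφψ⟩,
      fun ⟨v, hwv, hvφ, _⟩ => le_trans hwv hvφ⟩

theorem isGradedValuation (h : IsRealValuation S V) {Sig : Set Formula} (hfin : Sig.Finite) :
    IsGradedValuation Sig S fun t (w : PositiveDegree) => {χ | w ≤ V χ t} where
  antitone _ _ _ hvw _ := (Subtype.coe_le_coe.2 hvw).trans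
  and φ ψ t w := by simp only [h.and, Set.mem_ofPred_eq, le_min_iff]
  or φ ψ t w := by simp only [h.or, Set.mem_ofPred_eq, le_max_iff]
  imp φ ψ t w := h.le_imp_iff φ ψ t w
  coimp φ ψ t w := h.le_coimp_iff φ ψ t w
  next φ t w := by simp only [h.next, Set.mem_ofPred_eq]
  yest φ t w := by simp only [h.yest, Set.mem_ofPred_eq]
  glob φ t w := by simp only [le_isGLB_iff (h.glob φ t), mem_lowerBounds, Set.forall_mem_range,
    Set.mem_ofPred_eq]
  hist φ t w := by simp only [le_isGLB_iff (h.hist φ t), mem_lowerBounds, Set.forall_mem_range,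
    Set.mem_ofPred_eq]
  untl_unfold φ ψ t w := by
    have hunfold := until_eq_max_min (h.untl φ ψ t)
      (by simpa only [pow_succ, Equiv.Perm.mul_apply] using h.untl φ ψ (S t))
    rw [Set.mem_ofPred_eq, hunfold, le_max_iff, le_min_iff]
    rfl
  snce_unfold φ ψ t w := by
    have hunfold := until_eq_max_min (h.snce φ ψ t)
      (by simpa only [pow_succ, Equiv.Perm.mul_apply] using h.snce φ ψ (S⁻¹ t))
    rw [Set.mem_ofPred_eq, hunfold, le_max_iff, le_min_iff]
    rfl
  untl_realised φ ψ t w hw := by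
    obtain ⟨v, hvw, hv⟩ := w.exists_lt_inter_eq hfin (V · t)
    obtain ⟨n, -, hn⟩ := (lt_iff_exists_until (h.untl φ ψ t)).1 (lt_of_lt_of_le hvw hw)
    exact ⟨v, hv, n, hn.le⟩
  snce_realised φ ψ t w hw := by
    obtain ⟨v, hvw, hv⟩ := w.exists_lt_inter_eq hfin (V · t)
    obtain ⟨n, -, hn⟩ := (lt_iff_exists_until (h.snce φ ψ t)).1 (lt_of_lt_of_le hvw hw)
    exact ⟨v, hv, n, hn.le⟩

end IsRealValuation

namespace IsGradedValuation

variable {L T : Type*} [LinearOrder L] {Sig : Set Formula} {S : Equiv.Perm T}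
  {sat : T → L → Set Formula}

theorem isSigType (h : IsGradedValuation Sig S sat) (hsub : SubformulaClosed Sig) (t : T) (w : L) :
    IsSigType Sig (Sig ∩ sat t w) where
  subset := Set.inter_subset_left
  and φ ψ hm := by simp only [Set.mem_inter_iff, hm, hsub.and hm, h.and, true_and]
  or φ ψ hm := by simp only [Set.mem_inter_iff, hm, hsub.or hm, h.or, true_and]
  imp_elim φ ψ hm hi := Classical.or_iff_not_imp_left.2 fun hφ =>
    ⟨(hsub.imp hm).2, (h.imp φ ψ t w).1 hi.2 w le_rfl (not_not.1 hφ).2⟩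
  imp_intro φ ψ hm hψ := ⟨hm, (h.imp φ ψ t w).2 fun _ hvw _ => h.antitone t hvw hψ.2⟩
  coimp_elim φ ψ hm hc :=
    have ⟨_, hwv, hφ, _⟩ := (h.coimp φ ψ t w).1 hc.2
    ⟨(hsub.coimp hm).1, h.antitone t hwv hφ⟩
  coimp_intro φ ψ hm hφ hψ :=
    ⟨hm, (h.coimp φ ψ t w).2 ⟨w, le_rfl, hφ.2, fun hn => hψ ⟨(hsub.coimp hm).2, hn⟩⟩⟩

theorem isLabelledSpace (h : IsGradedValuation Sig S sat) (hsub : SubformulaClosed Sig) (t : T) :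
    IsLabelledSpace Sig fun w => Sig ∩ sat t w where
  locallyLinear := ⟨⊤, fun v w => iff_of_true trivial (le_total v w)⟩
  isType := h.isSigType hsub t
  antitone _ _ hvw := Set.inter_subset_inter_right Sig (h.antitone t hvw)
  imp w φ ψ hm := by
    have hnot : .imp φ ψ ∉ sat t w := fun hn => hm.2 ⟨hm.1, hn⟩
    rw [h.imp] at hnot
    push Not at hnot
    obtain ⟨v, hvw, hφ, hψ⟩ := hnot
    exact ⟨v, hvw, ⟨(hsub.imp hm.1).1, hφ⟩, fun hn => hψ hn.2⟩
  coimp w φ ψ hm := by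
    obtain ⟨v, hwv, hφ, hψ⟩ := (h.coimp φ ψ t w).1 hm.2
    exact ⟨v, hwv, ⟨(hsub.coimp hm.1).1, hφ⟩, fun hn => hψ hn.2⟩

theorem glob_unfold (h : IsGradedValuation Sig S sat) (φ : Formula) (t : T) (w : L) :
    .glob φ ∈ sat t w ↔ φ ∈ sat t w ∧ .glob φ ∈ sat (S t) w := by
  simp only [h.glob, ← Equiv.Perm.mul_apply, ← pow_succ]
  exact Nat.and_forall_add_one.symm

theorem hist_unfold (h : IsGradedValuation Sig S sat) (φ : Formula) (t : T) (w : L) :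
    .hist φ ∈ sat t w ↔ φ ∈ sat t w ∧ .hist φ ∈ sat (S⁻¹ t) w := by
  simp only [h.hist, ← Equiv.Perm.mul_apply, ← pow_succ]
  exact Nat.and_forall_add_one.symm

theorem sensiblePair (h : IsGradedValuation Sig S sat) (hsub : SubformulaClosed Sig) (t : T)
    (w : L) : SensiblePair Sig (Sig ∩ sat t w) (Sig ∩ sat (S t) w) where
  next φ hm := by simp only [Set.mem_inter_iff, hm, hsub.next hm, h.next, true_and]
  yest φ hm := by
    simp only [Set.mem_inter_iff, hm, hsub.yest hm, h.yest, Equiv.Perm.inv_def,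
      Equiv.symm_apply_apply, true_and]
  glob φ hm := by
    simp only [Set.mem_inter_iff, hm, hsub.glob hm, h.glob_unfold φ t, true_and]
  hist φ hm := by
    simp only [Set.mem_inter_iff, hm, hsub.hist hm, h.hist_unfold φ (S t),
      Equiv.Perm.inv_def, Equiv.symm_apply_apply, true_and]
  untl φ ψ hm := by
    simp only [Set.mem_inter_iff, hm, hsub.untl hm, h.untl_unfold φ ψ t, true_and]
  snce φ ψ hm := by
    simp only [Set.mem_inter_iff, hm, hsub.snce hm, h.snce_unfold φ ψ (S t),
      Equiv.Perm.inv_def, Equiv.symm_apply_apply, true_and]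

end IsGradedValuation

/-! ### Eventualities and traces -/

/-- `χ` is an eventuality about the future, of the form `¬ G φ` or `φ U ψ`, that the `Sig`-type `Φ`
promises to realise. -/
inductive FuturePending (Sig Φ : Set Formula) : Formula → Prop
  | glob {φ : Formula} (mem : .glob φ ∈ Sig) (notMem : .glob φ ∉ Φ) : FuturePending Sig Φ (.glob φ)
  | untl {φ ψ : Formula} (mem : .untl φ ψ ∈ Sig) (mem_type : .untl φ ψ ∈ Φ) :
    FuturePending Sig Φ (.untl φ ψ)

/-- The eventuality `χ` about the future is realised at the type `Φ`. -/
inductive FutureRealised (Φ : Set Formula) : Formula → Prop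
  | glob {φ : Formula} (notMem : φ ∉ Φ) : FutureRealised Φ (.glob φ)
  | untl {φ ψ : Formula} (mem : ψ ∈ Φ) : FutureRealised Φ (.untl φ ψ)

/-- `χ` is an eventuality about the past, of the form `¬ H φ` or `φ S ψ`, that the `Sig`-type `Φ`
promises to realise. -/
inductive PastPending (Sig Φ : Set Formula) : Formula → Prop
  | hist {φ : Formula} (mem : .hist φ ∈ Sig) (notMem : .hist φ ∉ Φ) : PastPending Sig Φ (.hist φ)
  | snce {φ ψ : Formula} (mem : .snce φ ψ ∈ Sig) (mem_type : .snce φ ψ ∈ Φ) :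
    PastPending Sig Φ (.snce φ ψ)

/-- The eventuality `χ` about the past is realised at the type `Φ`. -/
inductive PastRealised (Φ : Set Formula) : Formula → Prop
  | hist {φ : Formula} (notMem : φ ∉ Φ) : PastRealised Φ (.hist φ)
  | snce {φ ψ : Formula} (mem : ψ ∈ Φ) : PastRealised Φ (.snce φ ψ)

section Eventualities

variable {Sig Φ Ψ : Set Formula} {χ : Formula}

theorem FuturePending.mem_sig (h : FuturePending Sig Φ χ) : χ ∈ Sig := by
  cases h <;> assumption

theorem PastPending.mem_sig (h : PastPending Sig Φ χ) : χ ∈ Sig := by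
  cases h <;> assumption

theorem SensiblePair.future_step (h : SensiblePair Sig Φ Ψ) (hχ : FuturePending Sig Φ χ) :
    FutureRealised Φ χ ∨ FuturePending Sig Ψ χ := by
  cases hχ with
  | glob hm hn => exact (not_and_or.1 (mt (h.glob _ hm).2 hn)).imp .glob (.glob hm)
  | untl hm hn => exact ((h.untl _ _ hm).1 hn).imp .untl fun hu => .untl hm hu.2

theorem SensiblePair.past_step (h : SensiblePair Sig Φ Ψ) (hχ : PastPending Sig Ψ χ) :
    PastRealised Ψ χ ∨ PastPending Sig Φ χ := by
  cases hχ with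
  | hist hm hn => exact (not_and_or.1 (mt (h.hist _ hm).2 hn)).imp .hist (.hist hm)
  | snce hm hn => exact ((h.snce _ _ hm).1 hn).imp .snce fun hs => .snce hm hs.2

theorem omegaSensible_of_realised {W : Type*} {l : W → Set Formula} {R : W → W → Prop}
    (hsub : SubformulaClosed Sig) (hl : ∀ w, l w ⊆ Sig)
    (future : ∀ w χ, FuturePending Sig (l w) χ →
      ∃ v, Relation.ReflTransGen R w v ∧ FutureRealised (l v) χ)
    (past : ∀ w χ, PastPending Sig (l w) χ →
      ∃ v, Relation.ReflTransGen R v w ∧ PastRealised (l v) χ) :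
    OmegaSensible Sig l R where
  glob w φ hφ := by
    obtain ⟨v, hwv, ⟨hv⟩⟩ := future w _ (.glob hφ.1 hφ.2)
    exact ⟨v, hwv, hsub.glob hφ.1, hv⟩
  hist w φ hφ := by
    obtain ⟨v, hvw, ⟨hv⟩⟩ := past w _ (.hist hφ.1 hφ.2)
    exact ⟨v, hvw, hsub.hist hφ.1, hv⟩
  untl w φ ψ hm := by
    obtain ⟨v, hwv, ⟨⟩ | ⟨hv⟩⟩ := future w _ (.untl (hl w hm) hm)
    exact ⟨v, hwv, hv⟩
  snce w φ ψ hm := by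
    obtain ⟨v, hvw, ⟨⟩ | ⟨hv⟩⟩ := past w _ (.snce (hl w hm) hm)
    exact ⟨v, hvw, hv⟩

end Eventualities

/-- A trace is a two-way infinite sequence of linear `Sig`-labelled spaces on a common set `L` of
degrees. Consecutive labels of a degree are sensible, and a pending eventuality is realised at
some degree having the same label at the present time. -/
structure IsTrace {L : Type*} [LinearOrder L] (Sig : Set Formula) (τ : ℤ → L → Set Formula) :
    Prop where
  labelledSpace : ∀ k, IsLabelledSpace Sig (τ k)
  sensible : ∀ k w, SensiblePair Sig (τ k w) (τ (k + 1) w)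
  future : ∀ k w χ, FuturePending Sig (τ k w) χ →
    ∃ v, τ k v = τ k w ∧ ∃ n : ℕ, FutureRealised (τ (k + n) v) χ
  past : ∀ k w χ, PastPending Sig (τ k w) χ →
    ∃ v, τ k v = τ k w ∧ ∃ n : ℕ, PastRealised (τ (k - n) v) χ

namespace IsGradedValuation

variable {L T : Type*} [LinearOrder L] {Sig : Set Formula} {S : Equiv.Perm T}
  {sat : T → L → Set Formula}

theorem future_realised (h : IsGradedValuation Sig S sat) (hsub : SubformulaClosed Sig) {t : T}
    {w : L} {χ : Formula} (hχ : FuturePending Sig (Sig ∩ sat t w) χ) :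
    ∃ v, Sig ∩ sat t v = Sig ∩ sat t w ∧
      ∃ n : ℕ, FutureRealised (Sig ∩ sat ((S ^ n) t) v) χ := by
  cases hχ with
  | @glob φ hm hn =>
    obtain ⟨n, hφ⟩ := not_forall.1 (mt (h.glob φ t w).2 fun hs => hn ⟨hm, hs⟩)
    exact ⟨w, rfl, n, .glob fun hs => hφ hs.2⟩
  | untl hm hn =>
    obtain ⟨v, hv, n, hψ⟩ := h.untl_realised _ _ t w hn.2
    exact ⟨v, hv, n, .untl ⟨(hsub.untl hm).2, hψ⟩⟩

theorem past_realised (h : IsGradedValuation Sig S sat) (hsub : SubformulaClosed Sig) {t : T}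
    {w : L} {χ : Formula} (hχ : PastPending Sig (Sig ∩ sat t w) χ) :
    ∃ v, Sig ∩ sat t v = Sig ∩ sat t w ∧
      ∃ n : ℕ, PastRealised (Sig ∩ sat ((S⁻¹ ^ n) t) v) χ := by
  cases hχ with
  | @hist φ hm hn =>
    obtain ⟨n, hφ⟩ := not_forall.1 (mt (h.hist φ t w).2 fun hs => hn ⟨hm, hs⟩)
    exact ⟨w, rfl, n, .hist fun hs => hφ hs.2⟩
  | snce hm hn =>
    obtain ⟨v, hv, n, hψ⟩ := h.snce_realised _ _ t w hn.2
    exact ⟨v, hv, n, .snce ⟨(hsub.snce hm).2, hψ⟩⟩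

theorem isTrace (h : IsGradedValuation Sig S sat) (hsub : SubformulaClosed Sig) (t : T) :
    IsTrace Sig fun k w => Sig ∩ sat ((S ^ k) t) w where
  labelledSpace k := h.isLabelledSpace hsub ((S ^ k) t)
  sensible k w := by
    rw [add_comm, zpow_one_add, Equiv.Perm.mul_apply]
    exact h.sensiblePair hsub ((S ^ k) t) w
  future k w χ hχ := by
    obtain ⟨v, hv, n, hn⟩ := h.future_realised hsub hχ
    refine ⟨v, hv, n, ?_⟩
    rwa [add_comm, zpow_add, zpow_natCast, Equiv.Perm.mul_apply]
  past k w χ hχ := by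
    obtain ⟨v, hv, n, hn⟩ := h.past_realised hsub hχ
    refine ⟨v, hv, n, ?_⟩
    rwa [sub_eq_neg_add, zpow_add, zpow_neg, zpow_natCast, ← inv_pow, Equiv.Perm.mul_apply]

end IsGradedValuation

open Filter in
theorem exists_loop {L α ι : Type*} {σ : ℕ → L → α} {A : Set α} (hA : A.Finite)
    (hσ : ∀ n w, σ n w ∈ A) {I : Set ι} (hI : I.Finite) {P Q : α → ι → Prop}
    (hPQ : ∀ n w, ∀ χ ∈ I, P (σ n w) χ → ∃ v, σ n v = σ n w ∧ ∃ m : ℕ, Q (σ (n + m) v) χ) :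
    ∃ i l : ℕ, 0 < i ∧ 0 < l ∧ Set.range (σ (i + l)) = Set.range (σ i) ∧
      ∀ w, ∀ χ ∈ I, P (σ i w) χ → ∃ v, σ i v = σ i w ∧ ∃ m ≤ l, Q (σ (i + m) v) χ := by
  obtain ⟨C, -, hC⟩ : ∃ C ∈ 𝒫 A, ∃ᶠ n in atTop, Set.range (σ n) = C :=
    (frequently_exists_finite hA.finite_subsets).1 <| Frequently.of_forall fun n =>
      ⟨_, Set.range_subset_iff.2 (hσ n), rfl⟩
  obtain ⟨i, hiC, hi⟩ := (hC.and_eventually (eventually_gt_atTop 0)).exists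
  have hbound : ∀ᶠ N in atTop, ∀ a ∈ A, ∀ χ ∈ I, a ∈ Set.range (σ i) → P a χ →
      ∃ v, σ i v = a ∧ ∃ m ≤ N, Q (σ (i + m) v) χ := by
    refine hA.eventually_all.2 fun a _ => hI.eventually_all.2 fun χ hχ => ?_
    by_cases ha : a ∈ Set.range (σ i) ∧ P a χ
    · obtain ⟨⟨w, rfl⟩, hP⟩ := ha
      obtain ⟨v, hv, m, hQ⟩ := hPQ i w χ hχ hP
      filter_upwards [eventually_ge_atTop m] with N hN _ _ using ⟨v, hv, m, hN, hQ⟩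
    · exact Eventually.of_forall fun N hw hP => absurd ⟨hw, hP⟩ ha
  obtain ⟨j, hjC, hij, hj⟩ := (hC.and_eventually
    ((eventually_gt_atTop i).and ((tendsto_sub_atTop_nat i).eventually hbound))).exists
  refine ⟨i, j - i, hi, Nat.sub_pos_of_lt hij, ?_, fun w χ hχ hP => ?_⟩
  · rw [Nat.add_sub_cancel' hij.le, hjC, hiC]
  · exact hj _ (hσ i w) χ hχ ⟨w, rfl⟩ hP

/-! ### Couplings of linear orders -/

/-- The relation that couples the two images of each value of a common parameter. -/
def Coupling {L A B : Type*} (p : L → A) (q : L → B) (a : A) (b : B) : Prop :=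
  ∃ w, p w = a ∧ q w = b

section Coupling

variable {L A B : Type*} [LinearOrder L] [PartialOrder A] [PartialOrder B] {p : L → A} {q : L → B}

theorem exists_eq_and_le (hp : Monotone p) (hq : Monotone q) {v w : L} (h : p v ≤ p w) :
    ∃ u, p u = p v ∧ q u ≤ q w :=
  (le_total v w).elim (fun hvw => ⟨v, rfl, hq hvw⟩) fun hwv => ⟨w, (hp hwv).antisymm h, le_rfl⟩

theorem exists_eq_and_ge (hp : Monotone p) (hq : Monotone q) {v w : L} (h : p w ≤ p v) :
    ∃ u, p u = p v ∧ q w ≤ q u :=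
  (le_total w v).elim (fun hwv => ⟨v, rfl, hq hwv⟩) fun hvw => ⟨w, h.antisymm (hp hvw), le_rfl⟩

theorem exists_eq_and_eq_of_mem_Icc (hp : Monotone p) (hq : Monotone q) {u v w : L}
    (huw : p u = p w) (hv : q v ∈ Set.Icc (q u) (q w)) : ∃ z, p z = p u ∧ q z = q v := by
  rcases le_total v u with hvu | huv
  · exact ⟨u, rfl, hv.1.antisymm (hq hvu)⟩
  rcases le_total w v with hwv | hvw
  · exact ⟨w, huw.symm, (hq hwv).antisymm hv.2⟩
  · exact ⟨v, ((hp hvw).trans huw.ge).antisymm (hp huv), rfl⟩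

theorem fullyConfluent_coupling (hp : Monotone p) (hq : Monotone q)
    (hpl : IsLowerSet (Set.range p)) (hpu : IsUpperSet (Set.range p))
    (hql : IsLowerSet (Set.range q)) (hqu : IsUpperSet (Set.range q)) :
    FullyConfluent (Coupling p q) where
  forth_down := by
    rintro a _ _ hle ⟨w, rfl, rfl⟩
    obtain ⟨v, rfl⟩ := hpl hle ⟨w, rfl⟩
    obtain ⟨u, hu, hle'⟩ := exists_eq_and_le hp hq hle
    exact ⟨q u, ⟨u, hu, rfl⟩, hle'⟩
  forth_up := by
    rintro _ a' _ hle ⟨w, rfl, rfl⟩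
    obtain ⟨v, rfl⟩ := hpu hle ⟨w, rfl⟩
    obtain ⟨u, hu, hle'⟩ := exists_eq_and_ge hp hq hle
    exact ⟨q u, ⟨u, hu, rfl⟩, hle'⟩
  back_down := by
    rintro _ b _ ⟨w, rfl, rfl⟩ hle
    obtain ⟨v, rfl⟩ := hql hle ⟨w, rfl⟩
    obtain ⟨u, hu, hle'⟩ := exists_eq_and_le hq hp hle
    exact ⟨p u, hle', u, rfl, hu⟩
  back_up := by
    rintro _ _ b' ⟨w, rfl, rfl⟩ hle
    obtain ⟨v, rfl⟩ := hqu hle ⟨w, rfl⟩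
    obtain ⟨u, hu, hle'⟩ := exists_eq_and_ge hq hp hle
    exact ⟨p u, hle', u, rfl, hu⟩

theorem convexRel_coupling (hp : Monotone p) (hq : Monotone q)
    (hpc : (Set.range p).OrdConnected) (hqc : (Set.range q).OrdConnected) :
    ConvexRel (Coupling p q) := by
  refine ⟨fun a => ⟨?_⟩, fun b => ⟨?_⟩⟩
  · rintro _ ⟨u, rfl, rfl⟩ _ ⟨w, hwu, rfl⟩ b hb
    obtain ⟨v, rfl⟩ := hqc.out ⟨u, rfl⟩ ⟨w, rfl⟩ hb
    exact exists_eq_and_eq_of_mem_Icc hp hq hwu.symm hb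
  · rintro _ ⟨u, rfl, rfl⟩ _ ⟨w, rfl, hwu⟩ a ha
    obtain ⟨v, rfl⟩ := hpc.out ⟨u, rfl⟩ ⟨w, rfl⟩ ha
    exact (exists_eq_and_eq_of_mem_Icc hq hp hwu.symm ha).imp fun _ => And.symm

end Coupling

section Union

variable {ι A B : Type*} [PartialOrder A] [PartialOrder B] {R : ι → A → B → Prop}

theorem fullyConfluent_exists (h : ∀ k, FullyConfluent (R k)) :
    FullyConfluent fun a b => ∃ k, R k a b where
  forth_down a a' b' hle := fun ⟨k, hk⟩ =>
    ((h k).forth_down a a' b' hle hk).imp fun _ hb => ⟨⟨k, hb.1⟩, hb.2⟩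
  forth_up a a' b hle := fun ⟨k, hk⟩ =>
    ((h k).forth_up a a' b hle hk).imp fun _ hb => ⟨⟨k, hb.1⟩, hb.2⟩
  back_down a' b b' := fun ⟨k, hk⟩ hle =>
    ((h k).back_down a' b b' hk hle).imp fun _ ha => ⟨ha.1, k, ha.2⟩
  back_up a b b' := fun ⟨k, hk⟩ hle =>
    ((h k).back_up a b b' hk hle).imp fun _ ha => ⟨ha.1, k, ha.2⟩

theorem convexRel_exists (h : ∀ k, ConvexRel (R k))
    (index_unique : ∀ j k a a' b b', R j a b → R k a' b' → a ≤ a' → b ≤ b' → j = k) :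
    ConvexRel fun a b => ∃ k, R k a b := by
  refine ⟨fun a => ⟨?_⟩, fun b => ⟨?_⟩⟩
  · rintro b ⟨j, hj⟩ b' ⟨k, hk⟩ c hc
    obtain rfl := index_unique j k a a b b' hj hk le_rfl (hc.1.trans hc.2)
    exact ⟨j, ((h j).1 a).out hj hk hc⟩
  · rintro a ⟨j, hj⟩ a' ⟨k, hk⟩ c hc
    obtain rfl := index_unique j k a a' b b hj hk (hc.1.trans hc.2) le_rfl
    exact ⟨j, ((h j).2 b).out hj hk hc⟩

end Union

theorem height_le_ncard_add_one {W α : Type*} [PartialOrder W] {l : W → Set α} (hl : StrictAnti l)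
    {s : Set α} (hs : s.Finite) (hls : ∀ w, l w ⊆ s) : height W ≤ (s.ncard : ℕ∞) + 1 := by
  refine iSup₂_le fun n ⟨w, hw⟩ => ?_
  have hanti : StrictAnti fun k => (l (w k)).ncard := fun j k hjk =>
    Set.ncard_lt_ncard (hl (hw hjk)) (hs.subset (hls _))
  have hle : ∀ k, (l (w k)).ncard < s.ncard + 1 := fun k =>
    Nat.lt_succ_of_le (Set.ncard_le_ncard (hls _) hs)
  have hcard := Fintype.card_le_of_injective (fun k => (⟨_, hle k⟩ : Fin (s.ncard + 1)))
    fun j k hjk => hanti.injective (Fin.mk.inj hjk)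
  rw [Fintype.card_fin, Fintype.card_fin] at hcard
  exact_mod_cast hcard

/-! ### Folding a trace to a double lasso -/

/-- The times from which a trace is folded: those of the double lasso, and one more at either end,
to be identified with the time at which the loop is entered. -/
def lassoWindow (i' l' i l : ℕ) : Set ℤ :=
  Set.Icc (-((i' : ℤ) + l')) ((i : ℤ) + l)

/-- The vertex of the double lasso to which a time of the window is folded. -/
def lassoFold (i' l' i l : ℕ) (k : ℤ) : ℤ :=
  if k = -((i' : ℤ) + l') then -i' else if k = (i : ℤ) + l then i else k

/-- `τ` folds to the double lasso with the given parameters: the set of labels repeats along both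
loops, and each eventuality pending where a loop is entered is realised within one turn. -/
structure IsFoldable {L : Type*} (Sig : Set Formula) (τ : ℤ → L → Set Formula)
    (i' l' i l : ℕ) : Prop where
  past_start_pos : 0 < i'
  past_length_pos : 0 < l'
  future_start_pos : 0 < i
  future_length_pos : 0 < l
  past_range : Set.range (τ (-((i' : ℤ) + l'))) = Set.range (τ (-i'))
  future_range : Set.range (τ ((i : ℤ) + l)) = Set.range (τ i)
  past_loop : ∀ w χ, PastPending Sig (τ (-i') w) χ → ∃ v, τ (-i') v = τ (-i') w ∧
    ∃ k ∈ Set.Icc (-((i' : ℤ) + l')) (-i'), PastRealised (τ k v) χ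
  future_loop : ∀ w χ, FuturePending Sig (τ i w) χ → ∃ v, τ i v = τ i w ∧
    ∃ k ∈ Set.Icc (i : ℤ) (i + l), FutureRealised (τ k v) χ

/-- A point of the folded trace: a vertex of the double lasso together with one of the labels
occurring at that time. -/
@[ext]
structure LassoPoint {L : Type*} (τ : ℤ → L → Set Formula) (i' l' i l : ℕ) : Type where
  pos : ℤ
  lab : Set Formula
  pos_mem : pos ∈ lassoVertices i' l' i l
  lab_mem : lab ∈ Set.range (τ pos)

instance {L : Type*} (τ : ℤ → L → Set Formula) (i' l' i l : ℕ) :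
    PartialOrder (LassoPoint τ i' l' i l) where
  le x y := x.pos = y.pos ∧ y.lab ⊆ x.lab
  le_refl _ := ⟨rfl, subset_rfl⟩
  le_trans _ _ _ hxy hyz := ⟨hxy.1.trans hyz.1, hyz.2.trans hxy.2⟩
  le_antisymm _ _ hxy hyx := LassoPoint.ext hxy.1 (hyx.2.antisymm hxy.2)

theorem LassoPoint.strictAnti_lab {L : Type*} {τ : ℤ → L → Set Formula} {i' l' i l : ℕ} :
    StrictAnti (LassoPoint.lab : LassoPoint τ i' l' i l → Set Formula) :=
  fun _ _ hxy => hxy.le.2.ssubset_of_ne fun hlab => hxy.ne (LassoPoint.ext hxy.le.1 hlab.symm)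

namespace IsTrace

variable {L : Type*} [LinearOrder L] {Sig : Set Formula} {τ : ℤ → L → Set Formula} {w : L}
  {χ : Formula}

theorem subset_sig (h : IsTrace Sig τ) (k : ℤ) (w : L) : τ k w ⊆ Sig :=
  ((h.labelledSpace k).isType w).subset

theorem antitone (h : IsTrace Sig τ) (k : ℤ) : Antitone (τ k) :=
  fun v w => (h.labelledSpace k).antitone v w

theorem future_realised_or_pending (h : IsTrace Sig τ) {a b : ℤ} (hab : a ≤ b)
    (hχ : FuturePending Sig (τ a w) χ) :
    (∃ k ∈ Set.Icc a b, FutureRealised (τ k w) χ) ∨ FuturePending Sig (τ b w) χ := by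
  induction b, hab using Int.leInduction with
  | base => exact .inr hχ
  | succ b hab ih =>
    rcases ih with ⟨k, hk, hreal⟩ | hpend
    · exact .inl ⟨k, ⟨hk.1, hk.2.trans (le_add_of_nonneg_right zero_le_one)⟩, hreal⟩
    · exact ((h.sensible b w).future_step hpend).imp_left fun hreal => ⟨b, ⟨hab, by lia⟩, hreal⟩

theorem past_realised_or_pending (h : IsTrace Sig τ) {a b : ℤ} (hab : a ≤ b)
    (hχ : PastPending Sig (τ b w) χ) :
    (∃ k ∈ Set.Icc a b, PastRealised (τ k w) χ) ∨ PastPending Sig (τ a w) χ := by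
  induction a, hab using Int.leInductionDown with
  | base => exact .inr hχ
  | pred a hab ih =>
    rcases ih with ⟨k, hk, hreal⟩ | hpend
    · exact .inl ⟨k, ⟨(sub_le_self a zero_le_one).trans hk.1, hk.2⟩, hreal⟩
    · have hsens := h.sensible (a - 1) w
      rw [sub_add_cancel] at hsens
      exact (hsens.past_step hpend).imp_left fun hreal => ⟨a, ⟨by lia, hab⟩, hreal⟩

theorem exists_isFoldable (h : IsTrace Sig τ) (hfin : Sig.Finite) :
    ∃ i' l' i l, IsFoldable Sig τ i' l' i l := by
  obtain ⟨i, l, hi, hl, hrange, hloop⟩ := exists_loop (σ := fun n : ℕ => τ n) hfin.finite_subsets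
    (fun n => h.subset_sig n) hfin (P := FuturePending Sig) (Q := FutureRealised)
    (by simpa using fun (n : ℕ) w χ _ => h.future n w χ)
  obtain ⟨i', l', hi', hl', hrange', hloop'⟩ := exists_loop (σ := fun n : ℕ => τ (-n))
    hfin.finite_subsets (fun n => h.subset_sig (-n)) hfin (P := PastPending Sig) (Q := PastRealised)
    (by simpa [← sub_eq_neg_add, neg_add'] using fun (n : ℕ) w χ _ => h.past (-n) w χ)
  refine ⟨i', l', i, l, hi', hl', hi, hl, by simpa using hrange', by simpa using hrange, ?_, ?_⟩
  · intro w χ hχ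
    obtain ⟨v, hv, m, hm, hreal⟩ := hloop' w χ hχ.mem_sig hχ
    exact ⟨v, hv, _, ⟨by lia, by lia⟩, hreal⟩
  · intro w χ hχ
    obtain ⟨v, hv, m, hm, hreal⟩ := hloop w χ hχ.mem_sig hχ
    exact ⟨v, hv, _, ⟨by lia, by lia⟩, hreal⟩

end IsTrace

namespace IsFoldable

variable {L : Type*} {Sig : Set Formula} {τ : ℤ → L → Set Formula} {i' l' i l : ℕ}

theorem lassoFold_mem (F : IsFoldable Sig τ i' l' i l) {k : ℤ} (hk : k ∈ lassoWindow i' l' i l) :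
    lassoFold i' l' i l k ∈ lassoVertices i' l' i l := by
  obtain ⟨hi', hl', hi, hl, -⟩ := F
  simp only [lassoWindow, lassoVertices, lassoFold, Set.mem_Icc] at hk ⊢
  lia

theorem range_lassoFold (F : IsFoldable Sig τ i' l' i l) (k : ℤ) :
    Set.range (τ (lassoFold i' l' i l k)) = Set.range (τ k) := by
  unfold lassoFold
  split_ifs with hpast hfuture
  · rw [hpast, F.past_range]
  · rw [hfuture, F.future_range]
  · rfl

theorem lassoFold_future_end (F : IsFoldable Sig τ i' l' i l) :
    lassoFold i' l' i l (i + l) = lassoFold i' l' i l i := by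
  obtain ⟨hi', hl', -⟩ := F
  simp only [lassoFold]
  lia

theorem lassoFold_past_end (F : IsFoldable Sig τ i' l' i l) :
    lassoFold i' l' i l (-(i' + l')) = lassoFold i' l' i l (-i') := by
  obtain ⟨hi', hl', -⟩ := F
  simp only [lassoFold]
  lia

theorem lassoEdge (F : IsFoldable Sig τ i' l' i l) {k : ℤ} (hk : k ∈ lassoWindow i' l' i l)
    (hk' : k + 1 ∈ lassoWindow i' l' i l) :
    LassoEdge i' l' i l (lassoFold i' l' i l k) (lassoFold i' l' i l (k + 1)) := by
  obtain ⟨hi', hl', -⟩ := F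
  simp only [lassoWindow, LassoEdge, lassoFold, Set.mem_Icc] at hk hk' ⊢
  lia

theorem lassoFold_edge_injective (F : IsFoldable Sig τ i' l' i l) {j k : ℤ}
    (hjk : lassoFold i' l' i l j = lassoFold i' l' i l k)
    (hjk' : lassoFold i' l' i l (j + 1) = lassoFold i' l' i l (k + 1)) : j = k := by
  obtain ⟨hi', hl', hi, -⟩ := F
  simp only [lassoFold] at hjk hjk'
  lia

/-- The point to which the degree `w` at time `k` is folded. -/
def point (F : IsFoldable Sig τ i' l' i l) {k : ℤ} (hk : k ∈ lassoWindow i' l' i l) (w : L) :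
    LassoPoint τ i' l' i l where
  pos := lassoFold i' l' i l k
  lab := τ k w
  pos_mem := F.lassoFold_mem hk
  lab_mem := F.range_lassoFold k ▸ Set.mem_range_self w

/-- The accessibility relation of the folded trace: each degree at a time is related to the same
degree at the next time. -/
def Rel (F : IsFoldable Sig τ i' l' i l) (x y : LassoPoint τ i' l' i l) : Prop :=
  ∃ k : {k : ℤ // k ∈ lassoWindow i' l' i l ∧ k + 1 ∈ lassoWindow i' l' i l},
    Coupling (F.point k.2.1) (F.point k.2.2) x y

theorem range_point (F : IsFoldable Sig τ i' l' i l) {k : ℤ} (hk : k ∈ lassoWindow i' l' i l) :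
    Set.range (F.point hk) = {x | x.pos = lassoFold i' l' i l k} := by
  ext x
  refine ⟨fun ⟨w, hw⟩ => hw ▸ rfl, fun hx => ?_⟩
  obtain ⟨w, hw⟩ : x.lab ∈ Set.range (τ k) := F.range_lassoFold k ▸ hx ▸ x.lab_mem
  exact ⟨w, LassoPoint.ext hx.symm hw⟩

theorem isLowerSet_range_point (F : IsFoldable Sig τ i' l' i l) {k : ℤ}
    (hk : k ∈ lassoWindow i' l' i l) : IsLowerSet (Set.range (F.point hk)) := by
  rw [F.range_point]
  exact fun x y hyx hx => hyx.1.trans hx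

theorem isUpperSet_range_point (F : IsFoldable Sig τ i' l' i l) {k : ℤ}
    (hk : k ∈ lassoWindow i' l' i l) : IsUpperSet (Set.range (F.point hk)) := by
  rw [F.range_point]
  exact fun x y hxy hx => hxy.1.symm.trans hx

theorem exists_eq_point_interior (F : IsFoldable Sig τ i' l' i l) (x : LassoPoint τ i' l' i l) :
    ∃ (k : ℤ) (hk : k ∈ lassoWindow i' l' i l) (_ : k - 1 ∈ lassoWindow i' l' i l)
      (_ : k + 1 ∈ lassoWindow i' l' i l) (w : L), F.point hk w = x := by
  have hfold : lassoFold i' l' i l x.pos = x.pos := by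
    have hx := x.pos_mem
    simp only [lassoVertices, lassoFold, Set.mem_Icc] at hx ⊢
    lia
  have hx := x.pos_mem
  simp only [lassoVertices, Set.mem_Icc] at hx
  have hwin : ∀ k, |k - x.pos| ≤ 1 → k ∈ lassoWindow i' l' i l := fun k hk => by
    rw [lassoWindow, Set.mem_Icc]
    rw [abs_le] at hk
    lia
  have hmem : x.pos ∈ lassoWindow i' l' i l := hwin _ (by simp)
  obtain ⟨w, hw⟩ : x ∈ Set.range (F.point hmem) := by
    rw [range_point]
    exact hfold.symm
  exact ⟨x.pos, hmem, hwin _ (by simp), hwin _ (by simp), w, hw⟩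

theorem reflTransGen_point (F : IsFoldable Sig τ i' l' i l) {j k : ℤ}
    (hj : j ∈ lassoWindow i' l' i l) (hk : k ∈ lassoWindow i' l' i l) (hjk : j ≤ k) (w : L) :
    Relation.ReflTransGen F.Rel (F.point hj w) (F.point hk w) := by
  induction k, hjk using Int.leInduction with
  | base => exact .refl
  | succ k hjk ih =>
    have hk' : k ∈ lassoWindow i' l' i l := Set.ordConnected_Icc.out hj hk ⟨hjk, by lia⟩
    exact (ih hk').tail ⟨⟨k, hk', hk⟩, w, rfl, rfl⟩

section Order

variable [LinearOrder L]

theorem monotone_point (F : IsFoldable Sig τ i' l' i l) (h : IsTrace Sig τ) {k : ℤ}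
    (hk : k ∈ lassoWindow i' l' i l) : Monotone (F.point hk) :=
  fun _ _ hvw => ⟨rfl, h.antitone k hvw⟩

theorem fullyConfluent_rel (F : IsFoldable Sig τ i' l' i l) (h : IsTrace Sig τ) :
    FullyConfluent F.Rel :=
  fullyConfluent_exists fun k => fullyConfluent_coupling (F.monotone_point h k.2.1)
    (F.monotone_point h k.2.2) (F.isLowerSet_range_point _) (F.isUpperSet_range_point _)
    (F.isLowerSet_range_point _) (F.isUpperSet_range_point _)

theorem convexRel_rel (F : IsFoldable Sig τ i' l' i l) (h : IsTrace Sig τ) : ConvexRel F.Rel := by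
  refine convexRel_exists (fun k => convexRel_coupling (F.monotone_point h k.2.1)
    (F.monotone_point h k.2.2) (F.isLowerSet_range_point _).ordConnected
    (F.isLowerSet_range_point _).ordConnected) ?_
  rintro j k _ _ _ _ ⟨v, rfl, rfl⟩ ⟨w, rfl, rfl⟩ hle hle'
  exact Subtype.ext (F.lassoFold_edge_injective hle.1 hle'.1)

theorem pos_eq_iff (F : IsFoldable Sig τ i' l' i l) (h : IsTrace Sig τ)
    {x y : LassoPoint τ i' l' i l} : x.pos = y.pos ↔ x ≤ y ∨ y ≤ x := by
  refine ⟨fun hxy => ?_, fun hxy => hxy.elim And.left fun hyx => hyx.1.symm⟩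
  obtain ⟨k, hk, -, -, w, rfl⟩ := F.exists_eq_point_interior x
  obtain ⟨v, rfl⟩ : y ∈ Set.range (F.point hk) := by
    rw [range_point]
    exact hxy.symm
  exact (le_total w v).imp (F.monotone_point h hk ·) (F.monotone_point h hk ·)

theorem isLabelledSpace (F : IsFoldable Sig τ i' l' i l) (h : IsTrace Sig τ) :
    IsLabelledSpace Sig (LassoPoint.lab : LassoPoint τ i' l' i l → Set Formula) where
  locallyLinear := ⟨Setoid.ker LassoPoint.pos, fun _ _ => F.pos_eq_iff h⟩
  isType x := by
    obtain ⟨k, hk, -, -, w, rfl⟩ := F.exists_eq_point_interior x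
    exact (h.labelledSpace k).isType w
  antitone _ _ hxy := hxy.2
  imp x φ ψ hm := by
    obtain ⟨k, hk, -, -, w, rfl⟩ := F.exists_eq_point_interior x
    obtain ⟨v, hvw, hv⟩ := (h.labelledSpace k).imp w φ ψ hm
    exact ⟨F.point hk v, F.monotone_point h hk hvw, hv⟩
  coimp x φ ψ hm := by
    obtain ⟨k, hk, -, -, w, rfl⟩ := F.exists_eq_point_interior x
    obtain ⟨v, hwv, hv⟩ := (h.labelledSpace k).coimp w φ ψ hm
    exact ⟨F.point hk v, F.monotone_point h hk hwv, hv⟩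

theorem isLabelledSystem (F : IsFoldable Sig τ i' l' i l) (h : IsTrace Sig τ) :
    IsLabelledSystem Sig (LassoPoint.lab : LassoPoint τ i' l' i l → Set Formula) F.Rel where
  toIsLabelledSpace := F.isLabelledSpace h
  serial x := by
    obtain ⟨k, hk, -, hsucc, w, rfl⟩ := F.exists_eq_point_interior x
    exact ⟨_, ⟨k, hk, hsucc⟩, w, rfl, rfl⟩
  serial_back x := by
    obtain ⟨k, hk, hpred, -, w, rfl⟩ := F.exists_eq_point_interior x
    obtain ⟨j, rfl⟩ : ∃ j, j + 1 = k := ⟨k - 1, sub_add_cancel k 1⟩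
    exact ⟨_, ⟨j, add_sub_cancel_right j 1 ▸ hpred, hk⟩, w, rfl, rfl⟩
  confluent := F.fullyConfluent_rel h
  convex := F.convexRel_rel h
  sensible := by
    rintro _ _ ⟨k, w, rfl, rfl⟩
    exact h.sensible k w

theorem ultimatelyPeriodic [Nonempty L] (F : IsFoldable Sig τ i' l' i l) (h : IsTrace Sig τ) :
    UltimatelyPeriodic F.Rel := by
  refine ⟨i', l', i, l, F.past_start_pos, F.past_length_pos, F.future_start_pos,
    F.future_length_pos, LassoPoint.pos, fun x => x.pos_mem, fun t ht => ?_, ?_⟩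
  · obtain ⟨w⟩ := ‹Nonempty L›
    let x : LassoPoint τ i' l' i l := ⟨t, τ t w, ht, w, rfl⟩
    exact ⟨x, Set.ext fun y => eq_comm.trans (F.pos_eq_iff h (x := x))⟩
  · rintro _ _ ⟨k, w, rfl, rfl⟩
    exact F.lassoEdge k.2.1 k.2.2

theorem exists_future_realised (F : IsFoldable Sig τ i' l' i l) (h : IsTrace Sig τ)
    (x : LassoPoint τ i' l' i l) (χ : Formula) (hχ : FuturePending Sig x.lab χ) :
    ∃ y, Relation.ReflTransGen F.Rel x y ∧ FutureRealised y.lab χ := by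
  obtain ⟨a, ha, -, -, w, rfl⟩ := F.exists_eq_point_interior x
  have hend : (i : ℤ) + l ∈ lassoWindow i' l' i l := ⟨by lia, le_rfl⟩
  have hstart : (i : ℤ) ∈ lassoWindow i' l' i l := ⟨by lia, by lia⟩
  rcases h.future_realised_or_pending ha.2 hχ with ⟨k, hk, hreal⟩ | hpend
  · have hkw := Set.ordConnected_Icc.out ha hend hk
    exact ⟨F.point hkw w, F.reflTransGen_point ha hkw hk.1 w, hreal⟩
  obtain ⟨v, hv⟩ : τ (i + l) w ∈ Set.range (τ i) := F.future_range ▸ Set.mem_range_self w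
  obtain ⟨u, huv, k, hk, hreal⟩ := F.future_loop v χ (hv ▸ hpend)
  have hloop : F.point hend w = F.point hstart u :=
    LassoPoint.ext F.lassoFold_future_end (hv.symm.trans huv.symm)
  have hkw := Set.ordConnected_Icc.out hstart hend hk
  refine ⟨F.point hkw u, .trans ?_ (F.reflTransGen_point hstart hkw hk.1 u), hreal⟩
  exact hloop ▸ F.reflTransGen_point ha hend ha.2 w

theorem exists_past_realised (F : IsFoldable Sig τ i' l' i l) (h : IsTrace Sig τ)
    (x : LassoPoint τ i' l' i l) (χ : Formula) (hχ : PastPending Sig x.lab χ) :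
    ∃ y, Relation.ReflTransGen F.Rel y x ∧ PastRealised y.lab χ := by
  obtain ⟨a, ha, -, -, w, rfl⟩ := F.exists_eq_point_interior x
  have hend : -((i' : ℤ) + l') ∈ lassoWindow i' l' i l := ⟨le_rfl, by lia⟩
  have hstart : -(i' : ℤ) ∈ lassoWindow i' l' i l := ⟨by lia, by lia⟩
  rcases h.past_realised_or_pending ha.1 hχ with ⟨k, hk, hreal⟩ | hpend
  · have hkw := Set.ordConnected_Icc.out hend ha hk
    exact ⟨F.point hkw w, F.reflTransGen_point hkw ha hk.2 w, hreal⟩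
  obtain ⟨v, hv⟩ : τ (-(i' + l')) w ∈ Set.range (τ (-i')) :=
    F.past_range ▸ Set.mem_range_self w
  obtain ⟨u, huv, k, hk, hreal⟩ := F.past_loop v χ (hv ▸ hpend)
  have hloop : F.point hend w = F.point hstart u :=
    LassoPoint.ext F.lassoFold_past_end (hv.symm.trans huv.symm)
  have hkw := Set.ordConnected_Icc.out hend hstart hk
  refine ⟨F.point hkw u, .trans (F.reflTransGen_point hkw hstart hk.2 u) ?_, hreal⟩
  exact hloop ▸ F.reflTransGen_point hend ha ha.1 w

theorem isQuasimodel (F : IsFoldable Sig τ i' l' i l) (h : IsTrace Sig τ)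
    (hsub : SubformulaClosed Sig) :
    IsQuasimodel Sig (LassoPoint.lab : LassoPoint τ i' l' i l → Set Formula) F.Rel where
  toIsLabelledSystem := F.isLabelledSystem h
  omega := omegaSensible_of_realised hsub (fun x => ((F.isLabelledSpace h).isType x).subset)
    (F.exists_future_realised h) (F.exists_past_realised h)

end Order

end IsFoldable

theorem IsTrace.exists_quasimodel {L : Type*} [LinearOrder L] {Sig : Set Formula}
    {τ : ℤ → L → Set Formula} (h : IsTrace Sig τ) (hfin : Sig.Finite)
    (hsub : SubformulaClosed Sig) {φ : Formula} (hφ : φ ∈ Sig) {w : L} (hw : φ ∉ τ 0 w) :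
    ∃ (W : Type) (_ : PartialOrder W) (l : W → Set Formula) (R : W → W → Prop),
      IsQuasimodel Sig l R ∧ UltimatelyPeriodic R ∧ height W ≤ (Sig.ncard : ℕ∞) + 1 ∧
        Falsifies Sig l φ := by
  obtain ⟨i', l', i, l, F⟩ := h.exists_isFoldable hfin
  have : Nonempty L := ⟨w⟩
  have hzero : (0 : ℤ) ∈ lassoVertices i' l' i l := by
    obtain ⟨hi', hl', hi, -⟩ := F
    rw [lassoVertices, Set.mem_Icc]
    lia
  have hquasi := F.isQuasimodel h hsub
  exact ⟨LassoPoint τ i' l' i l, inferInstance, LassoPoint.lab, F.Rel, hquasi,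
    F.ultimatelyPeriodic h,
    height_le_ncard_add_one LassoPoint.strictAnti_lab hfin fun x => (hquasi.isType x).subset,
    ⟨0, τ 0 w, hzero, Set.mem_range_self w⟩, hφ, hw⟩

end GTL

theorem mainTheorem6 (Sig : Set GTL.Formula) (hfin : Sig.Finite)
    (hsub : GTL.SubformulaClosed Sig) (φ : GTL.Formula) (hφ : φ ∈ Sig)
    (hfals : ¬ GTL.RealValid.{u} φ ∨ ¬ GTL.BiRelValid.{v, w} φ) :
    ∃ (W : Type) (_ : PartialOrder W) (l : W → Set GTL.Formula) (R : W → W → Prop),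
      GTL.IsQuasimodel Sig l R ∧ GTL.UltimatelyPeriodic R ∧
      GTL.height W ≤ (Sig.ncard : ℕ∞) + 1 ∧ GTL.Falsifies Sig l φ := by
  rcases hfals with hreal | hbirel
  · unfold GTL.RealValid at hreal
    push Not at hreal
    obtain ⟨T, S, V, hV, t, ht⟩ := hreal
    have htrace := (hV.isGradedValuation hfin).isTrace hsub t
    exact htrace.exists_quasimodel hfin hsub hφ (w := ⟨1, zero_lt_one⟩) fun hm =>
      ht (le_antisymm unitInterval.le_one' hm.2)
  · unfold GTL.BiRelValid at hbirel
    push Not at hbirel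
    obtain ⟨W, _, T, S, val, hval, hne⟩ := hbirel
    obtain ⟨⟨w, t⟩, hwt⟩ := (Set.ne_univ_iff_exists_notMem _).1 hne
    have htrace := (hval.isGradedValuation Sig).isTrace hsub t
    exact htrace.exists_quasimodel hfin hsub hφ (w := w) fun hm => hwt hm.2
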